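/- Let $K$ be a field of characteristic different from $2$. A superalgebra is a (not necessarily associative) $K$-algebra $A=A_0\oplus A_1$ with $A_iA_j\subseteq A_{i+j \bmod 2}$; it is bicommutative if $$a(bc)=(-1)^{\bar a\,\bar b}\,b(ac)\qquad\text{and}\qquad (ab)c=(-1)^{\bar b\,\bar c}\,(ac)b$$ for all homogeneous $a,b,c\in A$, where $\bar u\in\{0,1\}$ is the parity of $u$. Let $F$ be the free bicommutative superalgebra over $K$ with countably many free even generators $Y=\{y_1,y_2,\ldots\}$ and countably many free odd generators $Z=\{z_1,z_2,\ldots\}$. Let $A$ be a bicommutative superalgebra over $K$ and let $V=V_0\oplus V_1$, $V_i=V\cap A_i$, be a $\mathbb Z_2$-graded subspace which generates $A$ as an algebra. An element $f\in F$ is a weak polynomial super-identity of the pair $(A,V)$ if $\varphi(f)=0$ for every homomorphism $\varphi:F\to A$ with $\varphi(Y)\subseteq V_0$ and $\varphi(Z)\subseteq V_1$; let $T(A,V)\subseteq F$ be the set of all of them. A weak T-ideal of $F$ is a two-sided ideal $I$ of $F$ such that $\psi(I)\subseteq I$ for every algebra endomorphism $\psi$ of $F$ that sends each $y_i$ to a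 linear combination of elements of $Y$ and each $z_i$ to a linear combination of elements of $Z$. Then the weak polynomial super-identities of $(A,V)$ follow from finitely many of them: there is a finite subset $S\subseteq T(A,V)$ such that $T(A,V)$ is the smallest weak T-ideal of $F$ containing $S$. -/

import Mathlib

/-!
Nonassociative algebras over a field `K` are modelled, as in Mathlib, by
`[NonUnitalNonAssocRing A] [Module K A] [IsScalarTower K A A] [SMulCommClass K A A]`.
-/

namespace BicommSuper

noncomputable section

/-! ### Superalgebras and bicommutative superalgebras -/

section Superalgebra

variable {K A : Type*} [Field K] [NonUnitalNonAssocRing A] [Module K A]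

/-- The nonassociative algebra `A`, with the family of subspaces `𝒜 0` (even elements) and
`𝒜 1` (odd elements), is a superalgebra. -/
structure IsSuperalgebra (𝒜 : ZMod 2 → Submodule K A) : Prop where
  isInternal : DirectSum.IsInternal 𝒜
  mul_mem : ∀ (i j : ZMod 2) (a b : A), a ∈ 𝒜 i → b ∈ 𝒜 j → a * b ∈ 𝒜 (i + j)

/-- The sign `(-1) ^ (i * j)` for two parities `i` and `j`. -/
def sgn (K : Type*) [Field K] (i j : ZMod 2) : K := (-1 : K) ^ (i.val * j.val)

/-- The superalgebra `A = 𝒜 0 ⊕ 𝒜 1` is bicommutative: it satisfies the super-identities of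
super-left-commutativity and super-right-commutativity on homogeneous elements. -/
structure IsBicommutative (𝒜 : ZMod 2 → Submodule K A) : Prop extends IsSuperalgebra 𝒜 where
  left_comm : ∀ (i j k : ZMod 2) (a b c : A), a ∈ 𝒜 i → b ∈ 𝒜 j → c ∈ 𝒜 k →
    a * (b * c) = sgn K i j • (b * (a * c))
  right_comm : ∀ (i j k : ZMod 2) (a b c : A), a ∈ 𝒜 i → b ∈ 𝒜 j → c ∈ 𝒜 k →
    (a * b) * c = sgn K j k • ((a * c) * b)

/-- `V` is a `ℤ₂`-graded subspace: `V = V₀ + V₁` with `Vᵢ = V ∩ 𝒜 i`. -/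
def IsGradedSubspace (𝒜 : ZMod 2 → Submodule K A) (V : Submodule K A) : Prop :=
  V = (V ⊓ 𝒜 0) ⊔ (V ⊓ 𝒜 1)

/-- Two-sided ideals of a nonassociative algebra over `K` (in particular, subspaces). -/
structure IsIdeal (I : Submodule K A) : Prop where
  mul_mem_left : ∀ a b : A, b ∈ I → a * b ∈ I
  mul_mem_right : ∀ a b : A, a ∈ I → a * b ∈ I

/-- The two-sided ideal generated by a set. -/
def idealSpan (K : Type*) {A : Type*} [Field K] [NonUnitalNonAssocRing A] [Module K A]
    (S : Set A) : Submodule K A :=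
  sInf {I : Submodule K A | IsIdeal I ∧ S ⊆ I}

theorem isIdeal_idealSpan (S : Set A) : IsIdeal (idealSpan K S) where
  mul_mem_left a b hb := by
    rw [idealSpan, Submodule.mem_sInf] at hb ⊢
    exact fun I hI => hI.1.mul_mem_left a b (hb I hI)
  mul_mem_right a b ha := by
    rw [idealSpan, Submodule.mem_sInf] at ha ⊢
    exact fun I hI => hI.1.mul_mem_right a b (ha I hI)

end Superalgebra

/-! ### The free bicommutative superalgebra -/

/-- The free generators: `Sum.inl i` is the even variable `yᵢ` and `Sum.inr i` is the odd
variable `zᵢ`. -/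
abbrev Gen : Type := ℕ ⊕ ℕ

/-- The parity of a nonassociative monomial: the number of its odd variables modulo `2`. -/
def parity : FreeMagma Gen → ZMod 2
  | .of (.inl _) => 0
  | .of (.inr _) => 1
  | .mul u v => parity u + parity v

section Free

variable (K : Type*) [Field K]

/-- The free nonassociative algebra on the variables `yᵢ`, `zᵢ`. -/
abbrev FreeNA : Type _ := FreeNonUnitalNonAssocAlgebra K Gen

/-- A nonassociative monomial as an element of the free nonassociative algebra. -/
def mono (u : FreeMagma Gen) : FreeNA K := MonoidAlgebra.ofMagma K (FreeMagma Gen) u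

/-- The defining relators of the free bicommutative superalgebra. By multilinearity it is enough
to impose the two super-identities on monomials, which are homogeneous and span. -/
inductive Relator : FreeNA K → Prop
  | left_comm (u v w : FreeMagma Gen) : Relator
      (mono K u * (mono K v * mono K w)
        - sgn K (parity u) (parity v) • (mono K v * (mono K u * mono K w)))
  | right_comm (u v w : FreeMagma Gen) : Relator
      ((mono K u * mono K v) * mono K w
        - sgn K (parity v) (parity w) • ((mono K u * mono K w) * mono K v))

/-- The ideal of all consequences of the defining super-identities. -/
def relIdeal : Submodule K (FreeNA K) := idealSpan K {r | Relator K r}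

/-- The free bicommutative superalgebra `F` of countable rank over `K`, freely generated by
the even variables `y₀, y₁, …` and the odd variables `z₀, z₁, …`. -/
def FreeBicomm : Type _ := FreeNA K ⧸ relIdeal K

namespace FreeBicomm

instance : AddCommGroup (FreeBicomm K) := inferInstanceAs (AddCommGroup (FreeNA K ⧸ relIdeal K))

instance : Module K (FreeBicomm K) := inferInstanceAs (Module K (FreeNA K ⧸ relIdeal K))

/-- The quotient map. -/
def mk : FreeNA K →ₗ[K] FreeBicomm K := (relIdeal K).mkQ

variable {K} in
theorem mk_surjective : Function.Surjective (mk K) := (relIdeal K).mkQ_surjective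

variable {K} in
theorem mk_eq_zero {a : FreeNA K} : mk K a = 0 ↔ a ∈ relIdeal K :=
  Submodule.Quotient.mk_eq_zero _

/-- Multiplication on the quotient, as a bilinear map. -/
def mulHom : FreeBicomm K →ₗ[K] FreeBicomm K →ₗ[K] FreeBicomm K :=
  (relIdeal K).liftQ
    (LinearMap.flip ((relIdeal K).liftQ ((LinearMap.mul K (FreeNA K)).flip.compr₂ (mk K))
      (fun b hb => by
        rw [LinearMap.mem_ker]
        refine LinearMap.ext fun a => ?_
        exact mk_eq_zero.2 ((isIdeal_idealSpan _).mul_mem_left a b hb))))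
    (fun a ha => by
      rw [LinearMap.mem_ker]
      refine LinearMap.ext fun b => ?_
      obtain ⟨b, rfl⟩ := mk_surjective b
      exact mk_eq_zero.2 ((isIdeal_idealSpan _).mul_mem_right a b ha))

instance : Mul (FreeBicomm K) := ⟨fun a b => mulHom K a b⟩

theorem mk_mul (a b : FreeNA K) : mk K (a * b) = mk K a * mk K b := rfl

instance : NonUnitalNonAssocRing (FreeBicomm K) where
  left_distrib a b c := map_add (mulHom K a) b c
  right_distrib a b c := LinearMap.map_add₂ (mulHom K) a b c
  zero_mul a := LinearMap.map_zero₂ (mulHom K) a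
  mul_zero a := map_zero (mulHom K a)

instance : IsScalarTower K (FreeBicomm K) (FreeBicomm K) :=
  ⟨fun c a b => LinearMap.map_smul₂ (mulHom K) c a b⟩

instance : SMulCommClass K (FreeBicomm K) (FreeBicomm K) :=
  ⟨fun c a b => (map_smul (mulHom K a) c b).symm⟩

/-- The even free generators. -/
def y (i : ℕ) : FreeBicomm K := mk K (mono K (.of (.inl i)))

/-- The odd free generators. -/
def z (i : ℕ) : FreeBicomm K := mk K (mono K (.of (.inr i)))

end FreeBicomm

end Free

/-! ### Weak polynomial super-identities and weak T-ideals -/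

section Weak

variable {K A : Type*} [Field K] [NonUnitalNonAssocRing A] [Module K A]

/-- `f` is a weak polynomial super-identity of the pair `(A, V)`: it vanishes under every
homomorphism `φ : F → A` with `φ(yᵢ) ∈ V₀` and `φ(zᵢ) ∈ V₁` for all `i`. -/
def IsWeakIdentity (𝒜 : ZMod 2 → Submodule K A) (V : Submodule K A) (f : FreeBicomm K) : Prop :=
  ∀ φ : FreeBicomm K →ₙₐ[K] A,
    (∀ i, φ (FreeBicomm.y K i) ∈ V ⊓ 𝒜 0) → (∀ i, φ (FreeBicomm.z K i) ∈ V ⊓ 𝒜 1) → φ f = 0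

/-- A linear endomorphism of the free bicommutative superalgebra: every even variable is sent to
a linear combination of even variables and every odd variable to one of odd variables. -/
def IsLinearEndo (ψ : FreeBicomm K →ₙₐ[K] FreeBicomm K) : Prop :=
  (∀ i, ψ (FreeBicomm.y K i) ∈ Submodule.span K (Set.range (FreeBicomm.y K))) ∧
  (∀ i, ψ (FreeBicomm.z K i) ∈ Submodule.span K (Set.range (FreeBicomm.z K)))

/-- Weak T-ideals: two-sided ideals closed under all linear endomorphisms. -/
structure IsWeakTIdeal (I : Submodule K (FreeBicomm K)) : Prop extends IsIdeal I where
  map_mem : ∀ ψ : FreeBicomm K →ₙₐ[K] FreeBicomm K, IsLinearEndo ψ → ∀ f ∈ I, ψ f ∈ I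

/-- The set of consequences of `S` as weak super-identities: the smallest weak T-ideal
containing `S`. -/
def weakTIdealSpan (S : Set (FreeBicomm K)) : Submodule K (FreeBicomm K) :=
  sInf {I : Submodule K (FreeBicomm K) | IsWeakTIdeal I ∧ S ⊆ I}

end Weak

end

end BicommSuper

/-! The weak super-identities of `(A, V)` form a weak T-ideal, so it suffices that every weak
T-ideal of `F` is finitely generated. This is a Gröbner basis argument up to renaming of variables.

Up to sign, a monomial of `F` is determined by its generators, each marked as a left or a right
factor (`bmono_eq_or`). Signs are removed by passing to monomials modulo sign, an ordinary
bicommutative magma (`signCon`, `eq_of_leaves_eq`). Inclusion of marked leaves then means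
divisibility by one-sided multiplications (`exists_wordMul`), and Higman's lemma makes divisibility
up to increasing renaming a well-quasi-order (`wellQuasiOrdered_leaves`).

The well-founded rank `rk` is compatible with increasing renamings and these multiplications
(`rk_wordMul_lt`), so leading monomials propagate along this quasi-order
(`HasLead.exists_of_leaves_le`). Elements of the ideal realizing finitely many leading monomials
thus account for all of them, and reduction shows that they generate it (`le_of_hasLead`). -/

namespace BicommSuper

/-! ### Bicommutative magmas -/

section Magma

/-- Magmas that are left-commutative and right-commutative. -/
class BicommMagma (Q : Type*) extends Mul Q where
  left_comm : ∀ a b c : Q, a * (b * c) = b * (a * c)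
  right_comm : ∀ a b c : Q, (a * b) * c = (a * c) * b

variable {Q : Type*} [BicommMagma Q]

/-- Both sides equal `(b * d) * (a * c)`. Hence left and right multiplications commute on
decomposable elements. -/
theorem BicommMagma.mul_mul_mul_assoc (a b c d : Q) : a * ((b * c) * d) = (a * (b * c)) * d := by
  rw [right_comm b c d, left_comm a, right_comm b d, left_comm a b c]

/-- The decomposable elements of a magma. -/
abbrev Decomposable (Q : Type*) [Mul Q] : Type _ := {q : Q // ∃ a b, q = a * b}

/-- Multiplication by `x` on the left or on the right, depending on the side `s`. -/
def sideMul {Q : Type*} [Mul Q] (x : Q × Bool) (q : Q) : Q := if x.2 then q * x.1 else x.1 * q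

/-- `sideMul` as an action on decomposable elements. -/
def sideMulDec (x : Q × Bool) (q : Decomposable Q) : Decomposable Q :=
  ⟨sideMul x q.1, by
    unfold sideMul
    split_ifs
    exacts [⟨_, _, rfl⟩, ⟨_, _, rfl⟩]⟩

/-- This makes `act` independent of the order of the multiplications. Decomposability is essential:
on a single generator, the two identities do not permute multiplications on the same side. -/
instance : LeftCommutative (sideMulDec (Q := Q)) where
  left_comm := by
    rintro ⟨x, _ | _⟩ ⟨y, _ | _⟩ ⟨_, b, c, rfl⟩ <;> apply Subtype.ext <;>
      simp only [sideMulDec, sideMul, if_true, if_false, Bool.false_eq_true]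
    · exact BicommMagma.left_comm _ _ _
    · exact BicommMagma.mul_mul_mul_assoc _ _ _ _
    · exact (BicommMagma.mul_mul_mul_assoc _ _ _ _).symm
    · exact BicommMagma.right_comm _ _ _

/-- The action of a multiset of one-sided multiplications on decomposable elements. -/
def act (M : Multiset (Q × Bool)) (q : Decomposable Q) : Decomposable Q := M.foldr sideMulDec q

/-- The product of two elements as a decomposable element. -/
def dmul (a b : Q) : Decomposable Q := ⟨a * b, a, b, rfl⟩

theorem act_zero (q : Decomposable Q) : act 0 q = q := rfl

theorem act_cons (x : Q × Bool) (M : Multiset (Q × Bool)) (q : Decomposable Q) :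
    act (x ::ₘ M) q = sideMulDec x (act M q) := Multiset.foldr_cons _ _ _ _

theorem act_add (M N : Multiset (Q × Bool)) (q : Decomposable Q) :
    act (M + N) q = act M (act N q) := Multiset.foldr_add _ _ _ _

theorem act_cons' (x : Q × Bool) (M : Multiset (Q × Bool)) (q : Decomposable Q) :
    act (x ::ₘ M) q = act M (sideMulDec x q) := by
  rw [← Multiset.singleton_add, add_comm, act_add]
  rfl

theorem act_mul (M : Multiset (Q × Bool)) (s : Decomposable Q) (t : Q) :
    dmul (act M s).1 t = act M (dmul s.1 t) := by
  induction M using Multiset.induction with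
  | empty => rfl
  | cons x M ih =>
    rw [act_cons, act_cons, ← ih]
    obtain ⟨_, b, c, hq⟩ := act M s
    subst hq
    apply Subtype.ext
    obtain ⟨x, _ | _⟩ := x
    · exact (BicommMagma.mul_mul_mul_assoc x b c t).symm
    · exact BicommMagma.right_comm _ _ _

theorem mul_act (M : Multiset (Q × Bool)) (s : Q) (t : Decomposable Q) :
    dmul s (act M t).1 = act M (dmul s t.1) := by
  induction M using Multiset.induction with
  | empty => rfl
  | cons x M ih =>
    rw [act_cons, act_cons, ← ih]
    obtain ⟨_, b, c, hq⟩ := act M t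
    subst hq
    apply Subtype.ext
    obtain ⟨x, _ | _⟩ := x
    · exact BicommMagma.left_comm _ _ _
    · exact BicommMagma.mul_mul_mul_assoc _ _ _ _

/-! ### Marked leaves and normal forms of monomials -/

variable {X : Type*}

/-- The multiset of the leaves of a monomial. Every leaf is marked with `1` if it is the left child
of its parent and with `2` if it is the right child; a leaf which is the whole monomial gets the
mark `s`. -/
def leaves : Fin 3 → FreeMagma X → Multiset (X × Fin 3)
  | s, .of x => {(x, s)}
  | _, .mul u v => leaves 1 u + leaves 2 v

@[simp] theorem leaves_of (s : Fin 3) (x : X) : leaves s (.of x) = {(x, s)} := rfl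

@[simp] theorem leaves_mul (s : Fin 3) (u v : FreeMagma X) :
    leaves s (u * v) = leaves 1 u + leaves 2 v := rfl

/-- The mark of a leaf on the given side. -/
def sideMark (s : Bool) : Fin 3 := if s then 2 else 1

/-- The leaf of a one-sided multiplication by a generator. -/
def markLeaf (x : X × Bool) : X × Fin 3 := (x.1, sideMark x.2)

@[simp] theorem markLeaf_false (x : X) : markLeaf (x, false) = (x, 1) := rfl

@[simp] theorem markLeaf_true (x : X) : markLeaf (x, true) = (x, 2) := rfl

theorem markLeaf_injective : Function.Injective (markLeaf (X := X)) := by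
  rintro ⟨x, _ | _⟩ ⟨y, _ | _⟩ h <;> simp_all [markLeaf, sideMark]

/-- The map on marked leaves induced by a map on generators. -/
abbrev actWord (f : FreeMagma X →ₙ* Q) (M : Multiset (X × Bool)) : Multiset (Q × Bool) :=
  M.map (Prod.map (f ∘ .of) id)

/-- By induction, every non-generator monomial is a core product of two generators under one-sided
multiplications by generators. The core contributes one leaf of each mark. -/
theorem exists_normalForm (f : FreeMagma X →ₙ* Q) (u : FreeMagma X) :
    (∃ x, u = .of x) ∨ ∃ (M : Multiset (X × Bool)) (x y : X),
      f u = (act (actWord f M) (dmul (f (.of x)) (f (.of y)))).1 ∧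
      ∀ s, leaves s u = M.map markLeaf + {(x, 1), (y, 2)} := by
  induction u using FreeMagma.recOnMul with
  | ih1 x => exact .inl ⟨x, rfl⟩
  | ih2 u v ihu ihv =>
    right
    obtain ⟨x, rfl⟩ | ⟨M, x, y, hu, hu'⟩ := ihu <;> obtain ⟨z, rfl⟩ | ⟨N, z, w, hv, hv'⟩ := ihv
    · exact ⟨0, x, z, by simp [act_zero, dmul], fun s => by simp⟩
    · refine ⟨(x, false) ::ₘ N, z, w, ?_, fun s => ?_⟩
      · simp [act_cons, hv, sideMulDec, sideMul]
      · simp [hv']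
    · refine ⟨(z, true) ::ₘ M, x, y, ?_, fun s => ?_⟩
      · simp [act_cons, hu, sideMulDec, sideMul]
      · simp only [leaves_mul, leaves_of, hu', Multiset.map_cons, markLeaf_true]
        simp only [← Multiset.singleton_add]
        abel
    · refine ⟨(z, false) ::ₘ (w, true) ::ₘ (N + M), x, y, ?_, fun s => ?_⟩
      -- Both actions are pulled out of the product; the two cores combine by `(xy)(zw) = z((xy)w)`,
      -- so `x, y` remains the core and `z`, `w` join the action.
      · have h := congrArg Subtype.val (act_mul (actWord f M) (dmul (f (.of x)) (f (.of y))) (f v))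
        rw [← hu] at h
        have h2 := mul_act (actWord f N) (dmul (f (.of x)) (f (.of y))).1
          (dmul (f (.of z)) (f (.of w)))
        rw [← hv] at h2
        rw [h2] at h
        have h3 : dmul (dmul (f (.of x)) (f (.of y))).1 (dmul (f (.of z)) (f (.of w))).1
            = sideMulDec (f (.of z), false)
              (sideMulDec (f (.of w), true) (dmul (f (.of x)) (f (.of y)))) :=
          Subtype.ext (BicommMagma.left_comm _ _ _)
        rw [h3, ← act_cons', ← act_cons', ← act_add] at h
        rw [map_mul]
        refine h.trans ?_
        congr 2
        simp only [actWord, Multiset.map_cons, Multiset.map_add, Prod.map, Function.comp, id]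
        simp only [← Multiset.singleton_add]
        abel
      · simp only [leaves_mul, hu', hv', Multiset.map_cons, Multiset.map_add, markLeaf_true,
          markLeaf_false, Multiset.insert_eq_cons]
        simp only [← Multiset.singleton_add]
        abel

/-- Since `x'(xy) = x(x'y)`, the left generator of the core is interchangeable with any left
multiplier. -/
theorem act_swap_left (M : Multiset (Q × Bool)) (x x' y : Q) :
    act ((x', false) ::ₘ M) (dmul x y) = act ((x, false) ::ₘ M) (dmul x' y) := by
  rw [act_cons', act_cons']
  congr 1
  exact Subtype.ext (BicommMagma.left_comm _ _ _)

theorem act_swap_right (M : Multiset (Q × Bool)) (x y y' : Q) :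
    act ((y', true) ::ₘ M) (dmul x y) = act ((y, true) ::ₘ M) (dmul x y') := by
  rw [act_cons', act_cons']
  congr 1
  exact Subtype.ext (BicommMagma.right_comm _ _ _)

/-- Which leaves form the core is immaterial: one exchange on the left and one on the right turn the
core `z, w` into `x, y`. -/
theorem act_dmul_eq (f : X → Q) {M N : Multiset (X × Bool)} {x y z w : X}
    (h : (x, false) ::ₘ (y, true) ::ₘ M = (z, false) ::ₘ (w, true) ::ₘ N) :
    act (M.map (Prod.map f id)) (dmul (f x) (f y)) =
      act (N.map (Prod.map f id)) (dmul (f z) (f w)) := by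
  obtain ⟨N', hN, h⟩ : ∃ N', act (N.map (Prod.map f id)) (dmul (f z) (f w)) =
      act (N'.map (Prod.map f id)) (dmul (f x) (f w)) ∧ (y, true) ::ₘ M = (w, true) ::ₘ N' := by
    obtain ⟨h1, h2⟩ | ⟨_, N₁, h1, h2⟩ := Multiset.cons_eq_cons.1 h
    · cases h1
      exact ⟨N, rfl, h2⟩
    · obtain ⟨h3, _⟩ | ⟨_, c, rfl, rfl⟩ := Multiset.cons_eq_cons.1 h2
      · simp at h3
      · refine ⟨(z, false) ::ₘ c, ?_, h1.trans (Multiset.cons_swap _ _ _)⟩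
        simp only [Multiset.map_cons]
        exact act_swap_left _ _ _ _
  rw [hN]
  obtain ⟨h1, rfl⟩ | ⟨_, c, rfl, rfl⟩ := Multiset.cons_eq_cons.1 h
  · cases h1
    rfl
  · simp only [Multiset.map_cons]
    exact act_swap_right _ _ _ _

/-- In a bicommutative magma, the value of a monomial depends only on its marked leaves. -/
theorem eq_of_leaves_eq (f : FreeMagma X →ₙ* Q) {u v : FreeMagma X}
    (h : leaves 0 u = leaves 0 v) : f u = f v := by
  obtain ⟨x, rfl⟩ | ⟨M, x, y, hu, hu'⟩ := exists_normalForm f u <;>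
    obtain ⟨z, rfl⟩ | ⟨N, z, w, hv, hv'⟩ := exists_normalForm f v
  · simp at h
    rw [h]
  · have := congrArg Multiset.card h
    simp [hv'] at this
  · have := congrArg Multiset.card h
    simp [hu'] at this
  · rw [hu, hv]
    congr 1
    apply act_dmul_eq
    apply Multiset.map_injective markLeaf_injective
    rw [hu', hv'] at h
    simp only [Multiset.map_cons, markLeaf_true, markLeaf_false]
    simpa [← Multiset.singleton_add, add_comm, add_left_comm, add_assoc] using h

end Magma

/-! ### Well-quasi-ordering of multisets up to increasing maps -/

section Multisets

variable {C : Type*}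

/-- Relabelling of the first components. -/
abbrev relabel (σ : ℕ → ℕ) : ℕ × C → ℕ × C := Prod.map σ id

/-- The word of multiplicities of a multiset, one letter for each first component below `N`. -/
def multWord [DecidableEq C] (m : Multiset (ℕ × C)) : List (C → ℕ) :=
  (List.range ((m.map Prod.fst).sup + 1)).map fun i c => m.count (i, c)

theorem multWord_getElem? [DecidableEq C] (m : Multiset (ℕ × C)) {x : ℕ × C} (hx : x ∈ m) :
    (multWord m)[x.1]? = some fun c => m.count (x.1, c) := by
  have : x.1 ≤ (m.map Prod.fst).sup := Multiset.le_sup (Multiset.mem_map_of_mem _ hx)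
  simp [multWord, Nat.lt_succ_of_le this]

theorem of_multWord_getElem? [DecidableEq C] (m : Multiset (ℕ × C)) {i : ℕ} {w : C → ℕ}
    (h : (multWord m)[i]? = some w) (c : C) : w c = m.count (i, c) := by
  simp only [multWord, List.getElem?_map, Option.map_eq_some_iff, List.getElem?_eq_some_iff,
    List.getElem_range] at h
  obtain ⟨_, ⟨_, rfl⟩, rfl⟩ := h
  rfl

/-- The embedding of positions in the words of multiplicities is the relabelling, and letterwise
comparison is the inequality of multiplicities. -/
theorem exists_relabel_le_of_sublistForall₂ [DecidableEq C] {m n : Multiset (ℕ × C)}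
    (h : List.SublistForall₂ (· ≤ ·) (multWord m) (multWord n)) :
    ∃ σ : ℕ ↪o ℕ, m.map (relabel σ) ≤ n := by
  obtain ⟨l, hl, hs⟩ := List.sublistForall₂_iff.1 h
  obtain ⟨σ, hσ⟩ := List.sublist_iff_exists_orderEmbedding_getElem?_eq.1 hs
  have hinj : Function.Injective (relabel (C := C) σ) := σ.injective.prodMap Function.injective_id
  refine ⟨σ, Multiset.le_iff_count.2 fun a => ?_⟩
  by_cases ha : a ∈ m.map (relabel σ)
  · obtain ⟨x, hx, rfl⟩ := Multiset.mem_map.1 ha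
    rw [Multiset.count_map_eq_count' _ _ hinj]
    have h1 := multWord_getElem? m hx
    obtain ⟨hi, h1⟩ := List.getElem?_eq_some_iff.1 h1
    have hi' : x.1 < l.length := hl.length_eq ▸ hi
    have h2 := hl.get hi hi'
    have h3 := hσ x.1
    rw [List.getElem?_eq_getElem hi'] at h3
    have h4 := of_multWord_getElem? n h3.symm x.2
    simp only [List.get_eq_getElem, h1] at h2
    have h5 := h2 x.2
    rw [h4] at h5
    exact h5
  · rw [Multiset.count_eq_zero_of_notMem ha]
    exact Nat.zero_le _

/-- A consequence of Higman's lemma: multisets over `ℕ × C`, with `C` finite, are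
well-quasi-ordered by inclusion up to increasing relabellings. -/
theorem wellQuasiOrdered_relabel_le [Finite C] :
    WellQuasiOrdered fun m n : Multiset (ℕ × C) => ∃ σ : ℕ ↪o ℕ, m.map (relabel σ) ≤ n := by
  classical
  -- Higman's lemma on words over `C → ℕ`, an alphabet well-quasi-ordered by Dickson's lemma because
  -- `C` is finite.
  have h := Set.PartiallyWellOrderedOn.partiallyWellOrderedOn_sublistForall₂
    (fun a b : C → ℕ => a ≤ b) (Set.isPWO_of_wellQuasiOrderedLE Set.univ)
  intro f
  obtain ⟨i, j, hij, hr⟩ := h (fun n => ⟨multWord (f n), by simp⟩)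
  exact ⟨i, j, hij, exists_relabel_le_of_sublistForall₂ hr⟩

/-! ### Colexicographic comparison of exponents -/

variable [LinearOrder C]

/-- Multisets as exponent vectors, ordered by comparison at the largest different place. -/
noncomputable def expo (m : Multiset (ℕ × C)) : Colex ((ℕ ×ₗ C) →₀ ℕ) := toColex (Multiset.toFinsupp (m.map toLex))

theorem expo_apply (m : Multiset (ℕ × C)) (a : ℕ × C) : ofColex (expo m) (toLex a) = m.count a := by
  rw [expo, ofColex_toColex, Multiset.toFinsupp_apply]
  exact Multiset.count_map_eq_count' _ _ toLex.injective _

theorem expo_injective : Function.Injective (expo (C := C)) := by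
  intro m n h
  ext a
  rw [← expo_apply, ← expo_apply, h]

theorem expo_add (m n : Multiset (ℕ × C)) : expo (m + n) = expo m + expo n := by
  simp [expo]

/-- The largest place of difference moves along `σ`, which preserves the order; places outside the
image have multiplicity zero on both sides. -/
theorem expo_relabel_lt {m n : Multiset (ℕ × C)} (σ : ℕ ↪o ℕ) (h : expo m < expo n) :
    expo (m.map (relabel σ)) < expo (n.map (relabel σ)) := by
  have hinj : Function.Injective (relabel (C := C) σ) := σ.injective.prodMap Function.injective_id
  rw [Finsupp.Colex.lt_iff] at h ⊢
  obtain ⟨i, hi, hlt⟩ := h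
  induction i using Lex.rec with | _ i
  refine ⟨toLex (relabel σ i), fun j hj => ?_, ?_⟩
  · induction j using Lex.rec with | _ j
    rw [expo_apply, expo_apply]
    by_cases hr : ∃ k, relabel σ k = j
    · obtain ⟨k, rfl⟩ := hr
      rw [Multiset.count_map_eq_count' _ _ hinj, Multiset.count_map_eq_count' _ _ hinj,
        ← expo_apply, ← expo_apply]
      apply hi
      simpa [Prod.Lex.toLex_lt_toLex] using hj
    · rw [Multiset.count_eq_zero_of_notMem, Multiset.count_eq_zero_of_notMem] <;>
        exact fun h => hr (by obtain ⟨k, _, hk⟩ := Multiset.mem_map.1 h; exact ⟨k, hk⟩)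
  · rw [expo_apply, expo_apply] at hlt ⊢
    rwa [Multiset.count_map_eq_count' _ _ hinj, Multiset.count_map_eq_count' _ _ hinj]

end Multisets

/-! ### The order on monomials -/

section Monomials

/-- The index of a generator, together with its parity and its mark. -/
def code (x : Gen × Fin 3) : ℕ × (Bool ×ₗ Fin 3) :=
  (x.1.elim id id, toLex (x.1.isRight, x.2))

theorem code_injective : Function.Injective code := by
  rintro ⟨i | i, s⟩ ⟨j | j, t⟩ h <;> simp_all [code]

/-- The action of a map on indices on the generators. -/
def genMap (σ : ℕ → ℕ) : Gen → Gen := Sum.map σ σ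

theorem code_genMap (σ : ℕ → ℕ) (x : Gen × Fin 3) :
    code (Prod.map (genMap σ) id x) = relabel σ (code x) := by
  obtain ⟨i | i, s⟩ := x <;> rfl

theorem leaves_map {X Y : Type*} (f : X → Y) (s : Fin 3) (u : FreeMagma X) :
    leaves s (FreeMagma.map f u) = (leaves s u).map (Prod.map f id) := by
  induction u using FreeMagma.recOnMul generalizing s with
  | ih1 x => rfl
  | ih2 u v hu hv => rw [map_mul, leaves_mul, leaves_mul, Multiset.map_add, hu, hv]

theorem card_leaves {X : Type*} (s : Fin 3) (u : FreeMagma X) :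
    (leaves s u).card = u.length := by
  induction u using FreeMagma.recOnMul generalizing s with
  | ih1 x => rfl
  | ih2 u v hu hv => rw [leaves_mul, Multiset.card_add, hu, hv]; rfl

theorem length_map {X Y : Type*} (f : X → Y) (u : FreeMagma X) :
    (FreeMagma.map f u).length = u.length := by
  rw [← card_leaves 0, leaves_map, Multiset.card_map, card_leaves]

theorem ne_zero_of_mem_leaves {X : Type*} {u : FreeMagma X} {s : Fin 3} (hs : s ≠ 0)
    {x : X × Fin 3} (hx : x ∈ leaves s u) : x.2 ≠ 0 := by
  induction u using FreeMagma.recOnMul generalizing s with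
  | ih1 y => simp_all
  | ih2 u v hu hv =>
    obtain h | h := Multiset.mem_add.1 hx
    exacts [hu (by simp) h, hv (by simp) h]

/-- The degree of a monomial followed by the exponents of its marked leaves. -/
noncomputable def rk (u : FreeMagma Gen) : ℕ ×ₗ Colex ((ℕ ×ₗ (Bool ×ₗ Fin 3)) →₀ ℕ) :=
  toLex (u.length, expo ((leaves 0 u).map code))

theorem rk_eq_iff {u v : FreeMagma Gen} : rk u = rk v ↔ leaves 0 u = leaves 0 v := by
  constructor
  · intro h
    exact Multiset.map_injective code_injective
      (expo_injective (congrArg (fun x => (ofLex x).2) h))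
  · intro h
    rw [rk, rk, ← card_leaves 0, ← card_leaves 0, h]

/-- Multiplication by several generators, each of them on one of the sides. -/
def wordMul {X : Type*} (l : List (X × Bool)) (u : FreeMagma X) : FreeMagma X :=
  l.foldr (fun x => sideMul (.of x.1, x.2)) u

theorem length_wordMul {X : Type*} (l : List (X × Bool)) (u : FreeMagma X) :
    (wordMul l u).length = l.length + u.length := by
  induction l with
  | nil => simp [wordMul]
  | cons x l ih =>
    have : (wordMul (x :: l) u).length = (wordMul l u).length + 1 := by
      obtain ⟨x, _ | _⟩ := x
      · exact add_comm _ _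
      · rfl
    rw [this, ih, List.length_cons]
    omega

theorem leaves_eq_of_two_le {X : Type*} {u : FreeMagma X} (hu : 2 ≤ u.length) (s t : Fin 3) :
    leaves s u = leaves t u := by
  cases u with
  | of x => simp [FreeMagma.length] at hu
  | mul u v => rfl

theorem leaves_wordMul {X : Type*} (l : List (X × Bool)) {u : FreeMagma X} (hu : 2 ≤ u.length)
    (s : Fin 3) :
    leaves s (wordMul l u) = Multiset.map markLeaf (l : Multiset (X × Bool)) + leaves s u := by
  induction l generalizing s with
  | nil => simp [wordMul]
  | cons x l ih =>
    rw [← Multiset.cons_coe, Multiset.map_cons, Multiset.cons_add,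
      -- In degree at least two the mark `s` does not matter; it is replaced by that of the side
      -- opposite to `x`, where the rest of the word sits.
      leaves_eq_of_two_le hu s (sideMark !x.2), ← ih, ← Multiset.singleton_add]
    obtain ⟨x, _ | _⟩ := x
    · rfl
    · exact add_comm _ _

/-- A strict inequality of degrees survives at once. In equal degrees the same leaves are added to
both exponents; `hl` excludes nontrivial multiplication of single generators, whose mark `0` would
change. -/
theorem rk_wordMul_lt (l : List (Gen × Bool)) (σ : ℕ ↪o ℕ) {u v : FreeMagma Gen}
    (hl : 2 ≤ v.length ∨ l = []) (h : rk u < rk v) :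
    rk (wordMul l (FreeMagma.map (genMap σ) u)) < rk (wordMul l (FreeMagma.map (genMap σ) v)) := by
  rw [rk, rk, Prod.Lex.toLex_lt_toLex] at h ⊢
  simp only [length_wordMul, length_map]
  obtain h | ⟨h1, h2⟩ := h
  · exact .inl (by simpa using h)
  refine .inr ⟨by simpa using h1, ?_⟩
  simp only at h1 h2
  have key : expo ((leaves 0 (FreeMagma.map (genMap σ) u)).map code) <
      expo ((leaves 0 (FreeMagma.map (genMap σ) v)).map code) := by
    simp only [leaves_map, Multiset.map_map, Function.comp_def, code_genMap]
    simpa only [Multiset.map_map, Function.comp_def] using expo_relabel_lt σ h2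
  obtain hv | rfl := hl
  · rw [leaves_wordMul l (by rw [length_map, h1]; exact hv),
      leaves_wordMul l (by rw [length_map]; exact hv), Multiset.map_add, Multiset.map_add,
      expo_add, expo_add]
    exact add_lt_add_right key _
  · exact key

theorem exists_markLeaf {X : Type*} (D : Multiset (X × Fin 3)) (h : ∀ x ∈ D, x.2 ≠ 0) :
    ∃ l : List (X × Bool), Multiset.map markLeaf (l : Multiset (X × Bool)) = D := by
  induction D using Multiset.induction with
  | empty => exact ⟨[], rfl⟩
  | cons x D ih =>
    obtain ⟨l, rfl⟩ := ih fun y hy => h y (Multiset.mem_cons_of_mem hy)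
    have hx := h x (Multiset.mem_cons_self _ _)
    obtain ⟨x, s⟩ := x
    fin_cases s
    · simp at hx
    · exact ⟨(x, false) :: l, by simp [← Multiset.cons_coe]⟩
    · exact ⟨(x, true) :: l, by simp [← Multiset.cons_coe]⟩

/-- The missing leaves, marked `1` or `2`, are supplied as right or left multipliers according to
their marks. A generator carries mark `0`, so its leaf is contained only in that of the same
generator. -/
theorem exists_wordMul {X : Type*} {u v : FreeMagma X} (h : leaves 0 u ≤ leaves 0 v) :
    ∃ l, leaves 0 (wordMul l u) = leaves 0 v ∧ (2 ≤ u.length ∨ l = []) := by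
  cases v with
  | of y =>
    refine ⟨[], Multiset.eq_of_le_of_card_le h ?_, .inr rfl⟩
    have := u.length_pos
    rwa [← card_leaves 0 u] at this
  | mul v w =>
    have hv : ∀ x ∈ leaves 0 (v.mul w), x.2 ≠ 0 := fun x hx =>
      ne_zero_of_mem_leaves (s := 1) (u := v.mul w) (by simp) hx
    cases u with
    | of x => exact absurd rfl (hv _ (Multiset.mem_of_le h (Multiset.mem_singleton_self _)))
    | mul p q =>
      have hu : 2 ≤ (p.mul q).length := Nat.add_le_add p.length_pos q.length_pos
      obtain ⟨D, hD⟩ := Multiset.le_iff_exists_add.1 h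
      obtain ⟨l, rfl⟩ := exists_markLeaf D fun x hx =>
        hv x (by rw [hD]; exact Multiset.mem_add.2 (.inr hx))
      exact ⟨l, by rw [leaves_wordMul l hu, hD, add_comm], .inl hu⟩

/-- Monomials are well-quasi-ordered by inclusion of marked leaves up to increasing maps of the
indices of the generators. -/
theorem wellQuasiOrdered_leaves : WellQuasiOrdered fun u v : FreeMagma Gen =>
    ∃ σ : ℕ ↪o ℕ, leaves 0 (FreeMagma.map (genMap σ) u) ≤ leaves 0 v := by
  intro f
  obtain ⟨i, j, hij, σ, h⟩ := wellQuasiOrdered_relabel_le fun n => (leaves 0 (f n)).map code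
  refine ⟨i, j, hij, σ, ?_⟩
  rw [← Multiset.map_le_map_iff code_injective, leaves_map]
  simpa only [Multiset.map_map, Function.comp_def, code_genMap] using h

end Monomials

noncomputable section

variable (K : Type*) [Field K]

/-! ### Monomials in the free bicommutative superalgebra -/

/-- A monomial as an element of the free bicommutative superalgebra. -/
def bmono : FreeMagma Gen →ₙ* FreeBicomm K where
  toFun u := FreeBicomm.mk K (mono K u)
  map_mul' u v := by rw [mono, map_mul]; rfl

theorem span_mono : Submodule.span K (Set.range (mono K)) = ⊤ := by
  refine eq_top_iff.2 fun f _ => ?_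
  induction f using MonoidAlgebra.induction_linear with
  | zero => exact zero_mem _
  | add f g hf hg => exact add_mem (hf trivial) (hg trivial)
  | single u c =>
    have : (MonoidAlgebra.single u c : FreeNA K) = c • mono K u := by
      simp [mono, MonoidAlgebra.ofMagma]
    rw [this]
    exact Submodule.smul_mem _ _ (Submodule.subset_span ⟨u, rfl⟩)

theorem span_bmono : Submodule.span K (Set.range (bmono K)) = ⊤ := by
  have : Set.range (bmono K) = FreeBicomm.mk K '' Set.range (mono K) := by
    rw [← Set.range_comp]; rfl
  rw [this, ← Submodule.map_span, span_mono, Submodule.map_top,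
    LinearMap.range_eq_top.2 FreeBicomm.mk_surjective]

theorem sgn_eq_or (i j : ZMod 2) : sgn K i j = 1 ∨ sgn K i j = -1 := neg_one_pow_eq_or K _

theorem mk_eq_of_relator {a b : FreeNA K} {i j : ZMod 2} (h : Relator K (a - sgn K i j • b)) :
    FreeBicomm.mk K a = FreeBicomm.mk K b ∨ FreeBicomm.mk K a = -FreeBicomm.mk K b := by
  have h0 : FreeBicomm.mk K (a - sgn K i j • b) = 0 := FreeBicomm.mk_eq_zero.2 <| by
    rw [relIdeal, idealSpan, Submodule.mem_sInf]
    exact fun I hI => hI.2 h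
  rw [map_sub, map_smul, sub_eq_zero] at h0
  rw [h0]
  obtain h | h := sgn_eq_or K i j <;> simp [h]

/-- Monomials are congruent if they coincide up to sign in the free bicommutative superalgebra. -/
def signCon : Con (FreeMagma Gen) where
  r u v := bmono K u = bmono K v ∨ bmono K u = -bmono K v
  iseqv :=
    { refl := fun _ => .inl rfl
      symm := by
        rintro u v (h | h)
        exacts [.inl h.symm, .inr (by rw [h, neg_neg])]
      trans := by rintro u v w (h | h) (h' | h') <;> simp [h, h'] }
  mul' := by rintro u v w x (h | h) (h' | h') <;> simp [map_mul, h, h']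

/-- The super-identities lose their signs in the quotient, so no sign has to be followed through the
normal form. -/
instance : BicommMagma (signCon K).Quotient where
  left_comm a b c := by
    induction a, b using Con.induction_on₂ with | _ u v
    induction c using Con.induction_on with | _ w
    refine (Con.eq _).2 ?_
    change bmono K _ = bmono K _ ∨ bmono K _ = -bmono K _
    simp only [map_mul]
    exact mk_eq_of_relator K (.left_comm u v w)
  right_comm a b c := by
    induction a, b using Con.induction_on₂ with | _ u v
    induction c using Con.induction_on with | _ w
    refine (Con.eq _).2 ?_
    change bmono K _ = bmono K _ ∨ bmono K _ = -bmono K _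
    simp only [map_mul]
    exact mk_eq_of_relator K (.right_comm u v w)

theorem bmono_eq_or {u v : FreeMagma Gen} (h : leaves 0 u = leaves 0 v) :
    bmono K u = bmono K v ∨ bmono K u = -bmono K v :=
  (Con.eq (signCon K)).1 (eq_of_leaves_eq
    { toFun := fun u => (u : (signCon K).Quotient), map_mul' := fun _ _ => rfl } h)

/-! ### Renaming the variables -/

/-- The endomorphism of the free nonassociative algebra renaming the variables. -/
def renameNA (σ : ℕ → ℕ) : FreeNA K →ₙₐ[K] FreeNA K :=
  FreeNonUnitalNonAssocAlgebra.lift K fun x => mono K (.of (genMap σ x))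

theorem renameNA_mono (σ : ℕ → ℕ) (u : FreeMagma Gen) :
    renameNA K σ (mono K u) = mono K (FreeMagma.map (genMap σ) u) := by
  induction u using FreeMagma.recOnMul with
  | ih1 x => exact FreeNonUnitalNonAssocAlgebra.lift_of_apply K _ _
  | ih2 u v hu hv =>
    have hm (u v : FreeMagma Gen) : mono K (u * v) = mono K u * mono K v := map_mul _ _ _
    rw [hm, map_mul, hu, hv, map_mul, hm]

theorem parity_map (σ : ℕ → ℕ) (u : FreeMagma Gen) :
    parity (FreeMagma.map (genMap σ) u) = parity u := by
  induction u using FreeMagma.recOnMul with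
  | ih1 x => cases x <;> rfl
  | ih2 u v hu hv => exact congrArg₂ (· + ·) hu hv

/-- Renaming preserves parities, hence sends relators to relators with the same sign. -/
theorem relIdeal_le_comap (σ : ℕ → ℕ) :
    relIdeal K ≤ (relIdeal K).comap (renameNA K σ : FreeNA K →ₗ[K] FreeNA K) := by
  refine sInf_le ⟨⟨fun a b hb => ?_, fun a b ha => ?_⟩, fun r hr => ?_⟩
  · rw [Submodule.mem_comap] at hb ⊢
    change renameNA K σ (a * b) ∈ _
    rw [map_mul]
    exact (isIdeal_idealSpan _).mul_mem_left _ _ hb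
  · rw [Submodule.mem_comap] at ha ⊢
    change renameNA K σ (a * b) ∈ _
    rw [map_mul]
    exact (isIdeal_idealSpan _).mul_mem_right _ _ ha
  · change renameNA K σ r ∈ relIdeal K
    rw [relIdeal, idealSpan, Submodule.mem_sInf]
    refine fun I hI => hI.2 ?_
    change Relator K r at hr
    change Relator K _
    cases hr with
    | left_comm u v w =>
      simp only [map_sub, map_smul, map_mul, renameNA_mono]
      rw [← parity_map σ u, ← parity_map σ v]
      exact .left_comm _ _ _
    | right_comm u v w =>
      simp only [map_sub, map_smul, map_mul, renameNA_mono]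
      rw [← parity_map σ v, ← parity_map σ w]
      exact .right_comm _ _ _

/-- The endomorphism of the free bicommutative superalgebra renaming the variables. -/
def rename (σ : ℕ → ℕ) : FreeBicomm K →ₙₐ[K] FreeBicomm K where
  toFun := (relIdeal K).mapQ (relIdeal K) (renameNA K σ : FreeNA K →ₗ[K] FreeNA K)
    (relIdeal_le_comap K σ)
  map_smul' c f := map_smul ((relIdeal K).mapQ _ _ (relIdeal_le_comap K σ)) c f
  map_zero' := map_zero ((relIdeal K).mapQ _ _ (relIdeal_le_comap K σ))
  map_add' f g := map_add ((relIdeal K).mapQ _ _ (relIdeal_le_comap K σ)) f g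
  map_mul' f g := by
    obtain ⟨a, rfl⟩ := FreeBicomm.mk_surjective f
    obtain ⟨b, rfl⟩ := FreeBicomm.mk_surjective g
    change FreeBicomm.mk K (renameNA K σ (a * b)) = _
    rw [map_mul]
    rfl

theorem rename_bmono (σ : ℕ → ℕ) (u : FreeMagma Gen) :
    rename K σ (bmono K u) = bmono K (FreeMagma.map (genMap σ) u) :=
  congrArg (FreeBicomm.mk K) (renameNA_mono K σ u)

theorem isLinearEndo_rename (σ : ℕ → ℕ) : IsLinearEndo (rename K σ) := by
  constructor <;> intro i
  · rw [show rename K σ (FreeBicomm.y K i) = FreeBicomm.y K (σ i) from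
      rename_bmono K σ (.of (.inl i))]
    exact Submodule.subset_span ⟨_, rfl⟩
  · rw [show rename K σ (FreeBicomm.z K i) = FreeBicomm.z K (σ i) from
      rename_bmono K σ (.of (.inr i))]
    exact Submodule.subset_span ⟨_, rfl⟩

/-! ### Leading monomials -/

/-- The span of the monomials below `ρ`. -/
def below (ρ : ℕ ×ₗ Colex ((ℕ ×ₗ (Bool ×ₗ Fin 3)) →₀ ℕ)) : Submodule K (FreeBicomm K) :=
  Submodule.span K (bmono K '' {u | rk u < ρ})

variable {K}

/-- `f` is the monomial `u` plus a linear combination of smaller monomials. -/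
def HasLead (f : FreeBicomm K) (u : FreeMagma Gen) : Prop := f - bmono K u ∈ below K (rk u)

theorem bmono_mem_below {ρ : ℕ ×ₗ Colex ((ℕ ×ₗ (Bool ×ₗ Fin 3)) →₀ ℕ)} {u : FreeMagma Gen}
    (h : rk u < ρ) : bmono K u ∈ below K ρ := Submodule.subset_span ⟨u, h, rfl⟩

theorem below_mono : Monotone (below K) := fun _ _ h =>
  Submodule.span_mono (Set.image_mono fun _ hw => lt_of_lt_of_le hw h)

/-- The top term is selected by rank alone: monomials of equal rank agree up to sign. Linear
independence of the monomials is not needed, and some may vanish. -/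
theorem exists_mem_span_singleton_sup (f : FreeBicomm K) (ρ) (hf : f ∈ below K ρ) (hf0 : f ≠ 0) :
    ∃ u, rk u < ρ ∧ f ∈ Submodule.span K {bmono K u} ⊔ below K (rk u) := by
  have hmono {u v : FreeMagma Gen} (huv : rk u ≤ rk v) :
      Submodule.span K {bmono K u} ⊔ below K (rk u) ≤
        Submodule.span K {bmono K v} ⊔ below K (rk v) := by
    refine sup_le ?_ ?_
    · rw [Submodule.span_singleton_le_iff_mem]
      obtain h | h := huv.lt_or_eq
      · exact Submodule.mem_sup_right (bmono_mem_below h)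
      · refine Submodule.mem_sup_left ?_
        obtain h | h := bmono_eq_or K (rk_eq_iff.1 h) <;> rw [h]
        · exact Submodule.mem_span_singleton_self _
        · exact neg_mem (Submodule.mem_span_singleton_self _)
    · exact le_sup_of_le_right
        (below_mono huv)
  refine Or.resolve_left ?_ hf0
  clear hf0
  induction hf using Submodule.span_induction with
  | mem f hf =>
    obtain ⟨u, hu, rfl⟩ := hf
    exact .inr ⟨u, hu, Submodule.mem_sup_left (Submodule.mem_span_singleton_self _)⟩
  | zero => exact .inl rfl
  | add f g _ _ hf hg =>
    obtain rfl | ⟨u, hu, hfu⟩ := hf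
    · simpa using hg
    obtain rfl | ⟨v, hv, hgv⟩ := hg
    · exact .inr ⟨u, hu, by simpa using hfu⟩
    obtain h | h := le_total (rk u) (rk v)
    · exact .inr ⟨v, hv, add_mem (hmono h hfu) hgv⟩
    · exact .inr ⟨u, hu, add_mem hfu (hmono h hgv)⟩
  | smul c f _ hf =>
    obtain rfl | ⟨u, hu, hfu⟩ := hf
    · simp
    · exact .inr ⟨u, hu, Submodule.smul_mem _ _ hfu⟩

theorem exists_mem_below (f : FreeBicomm K) : ∃ ρ, f ∈ below K ρ := by
  have hf : f ∈ Submodule.span K (Set.range (bmono K)) := by rw [span_bmono]; trivial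
  induction hf using Submodule.span_induction with
  | mem f hf =>
    obtain ⟨u, rfl⟩ := hf
    -- Degree is compared first, so one degree more bounds the monomial whatever the exponents.
    exact ⟨toLex (u.length + 1, 0), bmono_mem_below
      (Prod.Lex.toLex_lt_toLex.2 (.inl (Nat.lt_succ_self _)))⟩
  | zero => exact ⟨toLex (0, 0), zero_mem _⟩
  | add f g _ _ hf hg =>
    obtain ⟨ρ, hρ⟩ := hf
    obtain ⟨τ, hτ⟩ := hg
    exact ⟨max ρ τ, add_mem (below_mono (le_max_left _ _) hρ) (below_mono (le_max_right _ _) hτ)⟩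
  | smul c f _ hf =>
    obtain ⟨ρ, hρ⟩ := hf
    exact ⟨ρ, Submodule.smul_mem _ _ hρ⟩

/-- A subspace is determined inside a larger one by its leading monomials. -/
theorem le_of_hasLead {I J : Submodule K (FreeBicomm K)} (hJI : J ≤ I)
    (h : ∀ u, (∃ f ∈ I, HasLead f u) → ∃ g ∈ J, HasLead g u) : I ≤ J := by
  have key : ∀ ρ, ∀ f ∈ I, f ∈ below K ρ → f ∈ J := by
    intro ρ
    induction ρ using WellFoundedLT.induction with | _ ρ ih
    intro f hfI hf
    by_cases hf0 : f = 0
    · exact hf0 ▸ zero_mem _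
    obtain ⟨u, hu, hfu⟩ := exists_mem_span_singleton_sup f ρ hf hf0
    obtain ⟨a, ha, b, hb, rfl⟩ := Submodule.mem_sup.1 hfu
    obtain ⟨c, rfl⟩ := Submodule.mem_span_singleton.1 ha
    by_cases hc : c = 0
    · subst hc
      rw [zero_smul, zero_add] at hfI ⊢
      exact ih _ hu b hfI hb
    -- Division by `c` makes the leading coefficient one; subtracting `c • g` then cancels the top
    -- term and leaves an element of `I` below `rk u`.
    obtain ⟨g, hgJ, hg⟩ := h u ⟨c⁻¹ • (c • bmono K u + b), Submodule.smul_mem _ _ hfI, by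
      rw [HasLead, smul_add, inv_smul_smul₀ hc, add_sub_cancel_left]
      exact Submodule.smul_mem _ _ hb⟩
    have h1 : c • bmono K u + b - c • g ∈ J := by
      refine ih _ hu _ (sub_mem hfI (Submodule.smul_mem _ _ (hJI hgJ))) ?_
      have : c • bmono K u + b - c • g = b - c • (g - bmono K u) := by
        rw [smul_sub]
        abel
      rw [this]
      exact sub_mem hb (Submodule.smul_mem _ _ hg)
    simpa using add_mem h1 (Submodule.smul_mem _ c hgJ)
  intro f hf
  obtain ⟨ρ, hρ⟩ := exists_mem_below f
  exact key ρ f hf hρ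

/-! ### Finite generation of weak T-ideals -/

/-- Linearity lets the multiplication act on the leading monomial and all the lower terms at once.
-/
theorem exists_wordMul_linearMap (l : List (Gen × Bool)) :
    ∃ D : FreeBicomm K →ₗ[K] FreeBicomm K, (∀ u, D (bmono K u) = bmono K (wordMul l u)) ∧
      ∀ I : Submodule K (FreeBicomm K), IsIdeal I → ∀ f ∈ I, D f ∈ I := by
  induction l with
  | nil => exact ⟨LinearMap.id, fun u => rfl, fun I _ f hf => hf⟩
  | cons x l ih =>
    obtain ⟨D, hD, hDI⟩ := ih
    obtain ⟨x, _ | _⟩ := x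
    · refine ⟨LinearMap.mulLeft K (bmono K (.of x)) ∘ₗ D, fun u => ?_, fun I hI f hf =>
        hI.mul_mem_left (bmono K (.of x)) _ (hDI I hI f hf)⟩
      rw [LinearMap.comp_apply, hD, LinearMap.mulLeft_apply, ← map_mul]
      rfl
    · refine ⟨LinearMap.mulRight K (bmono K (.of x)) ∘ₗ D, fun u => ?_, fun I hI f hf =>
        hI.mul_mem_right _ (bmono K (.of x)) (hDI I hI f hf)⟩
      rw [LinearMap.comp_apply, hD, LinearMap.mulRight_apply, ← map_mul]
      rfl

/-- Rename by `σ`, then multiply by the missing leaves: the ideal is preserved and lower terms stay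
lower. -/
theorem HasLead.exists_of_leaves_le {J : Submodule K (FreeBicomm K)} (hJ : IsWeakTIdeal J)
    {f : FreeBicomm K} (hf : f ∈ J) {u v : FreeMagma Gen} (hu : HasLead f u) (σ : ℕ ↪o ℕ)
    (h : leaves 0 (FreeMagma.map (genMap σ) u) ≤ leaves 0 v) : ∃ g ∈ J, HasLead g v := by
  obtain ⟨l, hl, hl2⟩ := exists_wordMul h
  rw [length_map] at hl2
  obtain ⟨D, hD, hDJ⟩ := exists_wordMul_linearMap (K := K) l
  have hg : D (rename K σ f) ∈ J :=
    hDJ J hJ.toIsIdeal _ (hJ.map_mem _ (isLinearEndo_rename K σ) f hf)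
  have hlow : D (rename K σ f) - bmono K (wordMul l (FreeMagma.map (genMap σ) u)) ∈
      below K (rk v) := by
    rw [← hD, ← rename_bmono, ← map_sub, ← map_sub]
    have hle : below K (rk u) ≤ (below K (rk v)).comap
        (D ∘ₗ (rename K σ : FreeBicomm K →ₗ[K] FreeBicomm K)) := by
      refine Submodule.span_le.2 ?_
      rintro _ ⟨w, hw, rfl⟩
      change D (rename K σ (bmono K w)) ∈ below K (rk v)
      rw [rename_bmono, hD]
      refine bmono_mem_below ?_
      rw [← rk_eq_iff.2 hl]
      exact rk_wordMul_lt l σ hl2 hw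
    exact hle hu
  -- The monomial obtained is `v` only up to sign; in the negative case the element is negated.
  obtain h | h := bmono_eq_or K hl <;> rw [h] at hlow
  · exact ⟨_, hg, hlow⟩
  · refine ⟨_, neg_mem hg, ?_⟩
    have := neg_mem hlow
    rwa [neg_sub', sub_neg_eq_add, ← sub_eq_add_neg] at this

theorem isWeakTIdeal_weakTIdealSpan (S : Set (FreeBicomm K)) :
    IsWeakTIdeal (weakTIdealSpan S) where
  mul_mem_left a b hb := by
    rw [weakTIdealSpan, Submodule.mem_sInf] at hb ⊢
    exact fun I hI => hI.1.mul_mem_left a b (hb I hI)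
  mul_mem_right a b ha := by
    rw [weakTIdealSpan, Submodule.mem_sInf] at ha ⊢
    exact fun I hI => hI.1.mul_mem_right a b (ha I hI)
  map_mem ψ hψ f hf := by
    rw [weakTIdealSpan, Submodule.mem_sInf] at hf ⊢
    exact fun I hI => hI.1.map_mem ψ hψ f (hf I hI)

theorem subset_weakTIdealSpan (S : Set (FreeBicomm K)) : S ⊆ weakTIdealSpan S := fun f hf => by
  rw [SetLike.mem_coe, weakTIdealSpan, Submodule.mem_sInf]
  exact fun I hI => hI.2 hf

/-- Otherwise elements could be chosen successively, none above an earlier one, giving a bad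
sequence. -/
theorem _root_.WellQuasiOrdered.exists_finset {α : Type*} {r : α → α → Prop}
    (hr : WellQuasiOrdered r) (P : α → Prop) :
    ∃ s : Finset α, (∀ x ∈ s, P x) ∧ ∀ y, P y → ∃ x ∈ s, r x y := by
  by_contra! h
  obtain ⟨f, -, hf⟩ := exists_seq_of_forall_finset_exists P (fun x y => ¬ r x y) h
  obtain ⟨m, n, hmn, h⟩ := hr f
  exact hf m n hmn h

/-- Every weak T-ideal of the free bicommutative superalgebra is finitely generated. -/
theorem IsWeakTIdeal.exists_finset {I : Submodule K (FreeBicomm K)} (hI : IsWeakTIdeal I) :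
    ∃ S : Finset (FreeBicomm K), I = weakTIdealSpan (S : Set (FreeBicomm K)) := by
  classical
  obtain ⟨B, hB, hB'⟩ := wellQuasiOrdered_leaves.exists_finset fun u => ∃ f ∈ I, HasLead f u
  -- One element of `I` is chosen for each of the finitely many basic leading monomials; these are
  -- the generators.
  choose! F hFI hF using hB
  have hle : weakTIdealSpan (B.image F : Set (FreeBicomm K)) ≤ I := sInf_le ⟨hI, fun f hf => by
    obtain ⟨u, hu, rfl⟩ := Finset.mem_image.1 (Finset.mem_coe.1 hf)
    exact hFI u hu⟩
  refine ⟨B.image F, le_antisymm (le_of_hasLead hle fun v hv => ?_) hle⟩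
  obtain ⟨u, hu, σ, h⟩ := hB' v hv
  exact HasLead.exists_of_leaves_le (isWeakTIdeal_weakTIdealSpan _)
    (subset_weakTIdealSpan _ (Finset.mem_coe.2 (Finset.mem_image_of_mem F hu))) (hF u hu) σ h

/-! ### Weak identities -/

variable {A : Type*} [NonUnitalNonAssocRing A] [Module K A]

/-- The weak identities of a pair, as a subspace of the free bicommutative superalgebra. -/
def weakIdentities (𝒜 : ZMod 2 → Submodule K A) (V : Submodule K A) :
    Submodule K (FreeBicomm K) where
  carrier := {f | IsWeakIdentity 𝒜 V f}
  zero_mem' φ _ _ := map_zero φ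
  add_mem' hf hg φ hy hz := by rw [map_add, hf φ hy hz, hg φ hy hz, add_zero]
  smul_mem' c f hf φ hy hz := by rw [map_smul, hf φ hy hz, smul_zero]

/-- Closure under a linear endomorphism `ψ` holds because `φ ∘ ψ` is again an admissible
substitution, the graded parts of `V` being subspaces. -/
theorem isWeakTIdeal_weakIdentities (𝒜 : ZMod 2 → Submodule K A) (V : Submodule K A) :
    IsWeakTIdeal (weakIdentities 𝒜 V) where
  mul_mem_left a b hb φ hy hz := by rw [map_mul, hb φ hy hz, mul_zero]
  mul_mem_right a b ha φ hy hz := by rw [map_mul, ha φ hy hz, zero_mul]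
  map_mem ψ hψ f hf φ hy hz := by
    have hspan {s : Set (FreeBicomm K)} {W : Submodule K A} (hs : ∀ a ∈ s, φ a ∈ W)
        {a : FreeBicomm K} (ha : a ∈ Submodule.span K s) : φ a ∈ W :=
      (Submodule.span_le (p := W.comap (φ : FreeBicomm K →ₗ[K] A))).2 hs ha
    exact hf (φ.comp ψ) (fun i => hspan (by rintro _ ⟨j, rfl⟩; exact hy j) (hψ.1 i))
      fun i => hspan (by rintro _ ⟨j, rfl⟩; exact hz j) (hψ.2 i)

end

end BicommSuper
/-- The weak polynomial super-identities of a pair `(A, V)` follow from a finite number of them. -/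
theorem corollary5p7 {K : Type*} [Field K] (hK : ringChar K ≠ 2)
    {A : Type*} [NonUnitalNonAssocRing A] [Module K A] [IsScalarTower K A A] [SMulCommClass K A A]
    (𝒜 : ZMod 2 → Submodule K A) (hA : BicommSuper.IsBicommutative 𝒜)
    (V : Submodule K A) (hV : BicommSuper.IsGradedSubspace 𝒜 V)
    (hgen : NonUnitalAlgebra.adjoin K (V : Set A) = ⊤) :
    ∃ S : Finset (BicommSuper.FreeBicomm K),
      {f : BicommSuper.FreeBicomm K | BicommSuper.IsWeakIdentity 𝒜 V f} =
        (BicommSuper.weakTIdealSpan (S : Set (BicommSuper.FreeBicomm K)) :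
          Set (BicommSuper.FreeBicomm K)) := by
  obtain ⟨S, hS⟩ := (BicommSuper.isWeakTIdeal_weakIdentities 𝒜 V).exists_finset
  exact ⟨S, congrArg (SetLike.coe (A := Submodule K (BicommSuper.FreeBicomm K))) hS⟩
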